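/- Let $\nu$ be a positive integer, $k$ a real number with $k\le \nu-1$, and $C$ a nonzero complex number. Let $\mathbb{D}=\{z\in\mathbb{C}:|z|<1\}$ and, with the principal branch of the power, put $$F(z)=\int_0^z\frac{d\zeta}{(1-\zeta^\nu)^{(k+1)/\nu}},\qquad z\in\mathbb{D},$$ the integral being taken along the segment from $0$ to $z$. Let $S=\frac1C F(\mathbb{D})$ and $S^*=S\setminus\{0\}$. Let $\varphi$ be a $\mathcal{D}$-function with parameters $\nu,k,C$, that is, an analytic function $\varphi:S\to\mathbb{D}$ with $F(\varphi(z))=Cz$ for all $z\in S$ (so that $\varphi'=C(1-\varphi^\nu)^{(k+1)/\nu}$ in $S$). For $t<0$ let $|E_{S^*,\varphi}(t)|$ denote the length (one-dimensional Hausdorff measure) of the lemniscate $$E_{S^*,\varphi}(t)=\{z\in S^*:\ \ln|\varphi(z)|=t\}.$$ Then, for every $t\in(-\infty,0)$, $$|E_{S^*,\varphi}(t)|=\frac{2\pi e^{t}}{|C|}\;{}_2F_1\bigl(p,p;1;e^{2\nu t}\bigr),\qquad p=\frac{k+1}{2\nu},$$ where ${}_2F_1(a,b;c;x)$ is the Gauss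 hypergeometric function. In particular this length is finite. -/

import Mathlib

open MeasureTheory

/-- `F(z) = ∫₀^z dζ / (1 - ζ^ν)^((k+1)/ν)`, the integral being taken along the segment
`ζ = s z`, `0 ≤ s ≤ 1` (so `dζ = z ds`), with the principal branch of the power. -/
noncomputable def dIntegral (ν : ℕ) (k : ℝ) (z : ℂ) : ℂ :=
  ∫ s in (0 : ℝ)..1, z / (1 - ((s : ℂ) * z) ^ ν) ^ (((k + 1) / (ν : ℝ) : ℝ) : ℂ)

/-- The domain `S = (1/C) F(𝔻)`, where `𝔻` is the open unit disk. -/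
def dDomain (ν : ℕ) (k : ℝ) (C : ℂ) : Set ℂ :=
  (fun ζ : ℂ => (1 / C) * dIntegral ν k ζ) '' Metric.ball (0 : ℂ) 1

/-- `φ` is a `𝒟`-function with parameters `ν`, `k`, `C`: an analytic function `φ : S → 𝔻`
given by `F(φ(z)) = C z`. Nothing is required of the values of `φ` outside `S`. -/
structure IsDFunction (ν : ℕ) (k : ℝ) (C : ℂ) (φ : ℂ → ℂ) : Prop where
  analytic : AnalyticOnNhd ℂ φ (dDomain ν k C)
  mapsTo : Set.MapsTo φ (dDomain ν k C) (Metric.ball (0 : ℂ) 1)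
  dIntegral_eq : ∀ z ∈ dDomain ν k C, dIntegral ν k (φ z) = C * z

/-- The lemniscate `E_{U,f}(t) = {z ∈ U : ln |f(z)| = t}`; the equation is written as
`|f(z)| = e^t`, so that zeros of `f` never belong to it. -/
def lemniscateIn (U : Set ℂ) (f : ℂ → ℂ) (t : ℝ) : Set ℂ :=
  {z | z ∈ U ∧ ‖f z‖ = Real.exp t}

/-- The length `|E_{U,f}(t)|` of the lemniscate: its one-dimensional Hausdorff measure
(which for a simple rectifiable curve is the arc length). -/
noncomputable def lemniscateLength (U : Set ℂ) (f : ℂ → ℂ) (t : ℝ) : ENNReal :=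
  Measure.hausdorffMeasure 1 (lemniscateIn U f t)

/-! Put `G = F / C` and `r = e^t`. The given `φ` is a two-sided inverse of `G` on the disk: the
identity theorem upgrades the right inverse, so injectivity of `F` comes from the existence of `φ`.
The lemniscate is therefore the `G`-image of the circle `|ζ| = r`, traversed once, and its length is
`(r / |C|) ∫ |1 - ζ^ν|^(-2p) dθ`. The integrand is the square of `|(1 - ζ^ν)^(-p)|`, so Parseval's
identity for the binomial series turns the integral into `2π` times the sum of `multichoose p n ^ 2
* r^(2νn)`, which is the hypergeometric series. `hausdorffMeasure_image_Ioc_eq_integral_norm_deriv`,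
`analytic_rightInverse_leftInvOn` and `integral_norm_one_sub_cpow` carry these steps. -/

/-! ### Hausdorff measure of a `C¹` curve -/

section CurveLength

open Set Filter Topology
open scoped NNReal ENNReal

variable {E : Type*} [NormedAddCommGroup E] [NormedSpace ℝ E]

theorem norm_sub_sub_smul_le_of_norm_deriv_sub_le {γ γ' : ℝ → E}
    (hγ : ∀ x, HasDerivAt γ (γ' x) x) {s : Set ℝ} (hs : Convex ℝ s) {v : E} {ε : ℝ}
    (h : ∀ u ∈ s, ‖γ' u - v‖ ≤ ε) {x y : ℝ} (hx : x ∈ s) (hy : y ∈ s) :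
    ‖γ y - γ x - (y - x) • v‖ ≤ ε * |y - x| := by
  have hd : ∀ u ∈ s, HasDerivWithinAt (fun u => γ u - u • v) (γ' u - v) s u := by
    intro u _
    have := (hγ u).sub ((hasDerivAt_id u).smul_const v)
    simpa using! this.hasDerivWithinAt
  have := hs.norm_image_sub_le_of_norm_hasDerivWithin_le hd h hx hy
  rw [Real.norm_eq_abs] at this
  convert this using 2
  rw [sub_smul]; abel

variable [MeasurableSpace E] [BorelSpace E]

theorem hausdorffMeasure_image_Ioc_le {γ γ' : ℝ → E}
    (hγ : ∀ x, HasDerivAt γ (γ' x) x) {v : E} {ε x y : ℝ}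
    (h : ∀ u ∈ Icc x y, ‖γ' u - v‖ ≤ ε) (hxy : x ≤ y) :
    μH[1] (γ '' Ioc x y) ≤ ENNReal.ofReal ((‖v‖ + ε) * (y - x)) := by
  have hε : 0 ≤ ε := (norm_nonneg _).trans (h x (left_mem_Icc.2 hxy))
  have hL : LipschitzOnWith (Real.toNNReal (‖v‖ + ε)) γ (Ioc x y) := by
    refine LipschitzOnWith.of_dist_le_mul fun s hs u hu => ?_
    have := norm_sub_sub_smul_le_of_norm_deriv_sub_le hγ (convex_Icc x y) h
      (Ioc_subset_Icc_self hu) (Ioc_subset_Icc_self hs)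
    rw [Real.coe_toNNReal _ (by positivity), dist_eq_norm, Real.dist_eq]
    have h2 := norm_le_norm_sub_add (γ s - γ u) ((s - u) • v)
    rw [norm_smul, Real.norm_eq_abs] at h2
    linarith
  have := hL.hausdorffMeasure_image_le (d := 1) zero_le_one
  rw [hausdorffMeasure_real, Real.volume_Ioc, ENNReal.rpow_one] at this
  rwa [ENNReal.ofReal_mul (by positivity)]

/-- When `‖v‖ > ε`, `γ` expands distances by at least `‖v‖ - ε`, so its inverse on the arc is
Lipschitz and maps the arc back onto an interval of known length. -/
theorem le_hausdorffMeasure_image_Ioc {γ γ' : ℝ → E}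
    (hγ : ∀ x, HasDerivAt γ (γ' x) x) {v : E} {ε x y : ℝ}
    (h : ∀ u ∈ Icc x y, ‖γ' u - v‖ ≤ ε) (hxy : x ≤ y) :
    ENNReal.ofReal ((‖v‖ - ε) * (y - x)) ≤ μH[1] (γ '' Ioc x y) := by
  rcases le_or_gt (‖v‖ - ε) 0 with h0 | h0
  · rw [ENNReal.ofReal_of_nonpos (mul_nonpos_of_nonpos_of_nonneg h0 (by linarith))]
    exact zero_le
  have hA : ∀ s ∈ Ioc x y, ∀ u ∈ Ioc x y, (‖v‖ - ε) * |s - u| ≤ ‖γ s - γ u‖ := by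
    intro s hs u hu
    have := norm_sub_sub_smul_le_of_norm_deriv_sub_le hγ (convex_Icc x y) h
      (Ioc_subset_Icc_self hu) (Ioc_subset_Icc_self hs)
    have h2 := norm_sub_norm_le ((s - u) • v) (γ s - γ u)
    rw [norm_smul, Real.norm_eq_abs, norm_sub_rev ((s - u) • v)] at h2
    linarith
  have hinj : InjOn γ (Ioc x y) := by
    intro s hs u hu hsu
    have := hA s hs u hu
    rw [hsu, sub_self, norm_zero] at this
    have h3 : |s - u| ≤ 0 := by
      by_contra hc
      push Not at hc
      nlinarith
    exact sub_eq_zero.1 (abs_nonpos_iff.1 h3)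
  have hleft := hinj.leftInvOn_invFunOn
  have hL : LipschitzOnWith (Real.toNNReal (‖v‖ - ε)⁻¹) (Function.invFunOn γ (Ioc x y))
      (γ '' Ioc x y) := by
    refine LipschitzOnWith.of_dist_le_mul ?_
    rintro _ ⟨s, hs, rfl⟩ _ ⟨u, hu, rfl⟩
    rw [hleft hs, hleft hu, Real.coe_toNNReal _ (by positivity), dist_eq_norm (γ s), Real.dist_eq,
      inv_mul_eq_div, le_div_iff₀ h0, mul_comm]
    exact hA s hs u hu
  have := hL.hausdorffMeasure_image_le (d := 1) zero_le_one
  rw [hleft.image_image, hausdorffMeasure_real, Real.volume_Ioc, ENNReal.rpow_one] at this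
  rw [ENNReal.ofReal_mul h0.le]
  calc _ ≤ ENNReal.ofReal (‖v‖ - ε) * (ENNReal.ofReal (‖v‖ - ε)⁻¹ * μH[1] (γ '' Ioc x y)) := by
        gcongr; exact this
    _ = _ := by
      rw [← mul_assoc, ← ENNReal.ofReal_mul h0.le, mul_inv_cancel₀ h0.ne', ENNReal.ofReal_one,
        one_mul]

/-- The length of an injective `C¹` curve is the integral of its speed. -/
theorem hausdorffMeasure_image_Ioc_eq_integral_norm_deriv {γ γ' : ℝ → E}
    (hγ : ∀ x, HasDerivAt γ (γ' x) x) (hγ' : Continuous γ') {a b : ℝ} (hab : a ≤ b)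
    (hinj : InjOn γ (Ioc a b)) :
    μH[1] (γ '' Ioc a b) = ENNReal.ofReal (∫ x in a..b, ‖γ' x‖) := by
  have hcont : Continuous γ := continuous_iff_continuousAt.2 fun x => (hγ x).continuousAt
  obtain ⟨M, hM⟩ : ∃ M, ∀ u ∈ Icc a b, ‖γ' u‖ ≤ M :=
    isCompact_Icc.exists_bound_of_continuousOn hγ'.continuousOn
  have hM0 : 0 ≤ M := (norm_nonneg _).trans (hM a (left_mem_Icc.2 hab))
  have hup : ∀ x y, a ≤ x → x ≤ y → y ≤ b →
      μH[1] (γ '' Ioc x y) ≤ ENNReal.ofReal (M * (y - x)) := by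
    intro x y hx hxy hy
    have := hausdorffMeasure_image_Ioc_le hγ (v := 0) (ε := M) (x := x) (y := y)
      (fun u hu => by simpa using hM u ⟨hx.trans hu.1, hu.2.trans hy⟩) hxy
    simpa using this
  have hfin : ∀ x y, a ≤ x → x ≤ y → y ≤ b → μH[1] (γ '' Ioc x y) ≠ ∞ := fun x y hx hxy hy =>
    ((hup x y hx hxy hy).trans_lt ENNReal.ofReal_lt_top).ne
  -- `Φ y` is the length of the arc up to `y`. It is continuous with right derivative `‖γ' y‖`, so
  -- the fundamental theorem of calculus gives the claim.
  set Φ : ℝ → ℝ := fun y => (μH[1] (γ '' Ioc a y)).toReal with hΦ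
  have hadd : ∀ x y, a ≤ x → x ≤ y → y ≤ b →
      Φ y - Φ x = (μH[1] (γ '' Ioc x y)).toReal := by
    intro x y hx hxy hy
    have hmeas : MeasurableSet (γ '' Ioc x y) :=
      measurableSet_Ioc.image_of_continuousOn_injOn hcont.continuousOn
        (hinj.mono (Ioc_subset_Ioc hx hy))
    have hdisj : Disjoint (γ '' Ioc a x) (γ '' Ioc x y) := by
      rw [Set.disjoint_left]
      rintro _ ⟨s, hs, rfl⟩ ⟨u, hu, hsu⟩
      have := hinj ⟨hx.trans_lt hu.1, hu.2.trans hy⟩ ⟨hs.1, hs.2.trans (hxy.trans hy)⟩ hsu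
      exact absurd hs.2 (not_le.2 (this ▸ hu.1))
    simp only [hΦ]
    rw [← Ioc_union_Ioc_eq_Ioc hx hxy, image_union, measure_union hdisj hmeas,
      ENNReal.toReal_add (hfin a x le_rfl hx (hxy.trans hy)) (hfin x y hx hxy hy)]
    ring
  have hΦc : ContinuousOn Φ (uIcc a b) := by
    rw [uIcc_of_le hab]
    have : LipschitzOnWith (Real.toNNReal M) Φ (Icc a b) := by
      refine LipschitzOnWith.of_le_add_mul _ fun x hx y hy => ?_
      rw [Real.coe_toNNReal _ hM0, Real.dist_eq]
      rcases le_total x y with h | h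
      · have h1 := hadd x y hx.1 h hy.2
        have h2 : (0 : ℝ) ≤ (μH[1] (γ '' Ioc x y)).toReal := ENNReal.toReal_nonneg
        have : 0 ≤ M * |x - y| := by positivity
        linarith
      · have h1 := hadd y x hy.1 h hx.2
        have h2 := ENNReal.toReal_le_of_le_ofReal
          (mul_nonneg hM0 (sub_nonneg.2 h)) (hup y x hy.1 h hx.2)
        rw [abs_of_nonneg (sub_nonneg.2 h)]
        linarith
    exact this.continuousOn
  have hderiv : ∀ x ∈ Ioo (min a b) (max a b), HasDerivWithinAt Φ ‖γ' x‖ (Ioi x) x := by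
    rw [min_eq_left hab, max_eq_right hab]
    intro x hx
    rw [hasDerivWithinAt_iff_isLittleO, Asymptotics.isLittleO_iff]
    intro ε hε
    obtain ⟨δ, hδ, hball⟩ := Metric.continuousAt_iff.1 hγ'.continuousAt ε hε
    filter_upwards [Ioo_mem_nhdsGT (show x < min b (x + δ) from lt_min hx.2 (by linarith))]
      with y hy
    have hyb : y ≤ b := hy.2.le.trans (min_le_left _ _)
    have hyδ : y < x + δ := hy.2.trans_le (min_le_right _ _)
    -- With `v = γ' x`, the two arc bounds pinch `Φ y - Φ x` to within `ε * (y - x)` of `‖γ' x‖ * (y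
    -- - x)`.
    have hclose : ∀ u ∈ Icc x y, ‖γ' u - γ' x‖ ≤ ε := by
      intro u hu
      rw [← dist_eq_norm]
      refine (hball ?_).le
      rw [Real.dist_eq, abs_of_nonneg (by linarith [hu.1])]
      linarith [hu.2]
    have hsub : 0 ≤ y - x := by linarith [hy.1]
    rw [hadd x y hx.1.le hy.1.le hyb, Real.norm_eq_abs, Real.norm_eq_abs, abs_of_nonneg hsub,
      smul_eq_mul, abs_le]
    have h1 := ENNReal.toReal_le_of_le_ofReal
      (mul_nonneg (by positivity) hsub) (hausdorffMeasure_image_Ioc_le hγ hclose hy.1.le)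
    have h2 := (ENNReal.ofReal_le_iff_le_toReal (hfin x y hx.1.le hy.1.le hyb)).1
      (le_hausdorffMeasure_image_Ioc hγ hclose hy.1.le)
    constructor <;> linarith
  have := intervalIntegral.integral_eq_sub_of_hasDeriv_right hΦc hderiv
    (hγ'.norm.intervalIntegrable a b)
  rw [this, hadd a b le_rfl hab le_rfl, ENNReal.ofReal_toReal (hfin a b le_rfl hab le_rfl)]

end CurveLength

/-! ### Parseval's identity -/

section Parseval

open Complex ComplexConjugate

theorem integral_exp_int_mul_I (n : ℤ) :
    ∫ θ in (0 : ℝ)..2 * Real.pi, exp (n * θ * I) = if n = 0 then 2 * (Real.pi : ℂ) else 0 := by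
  split_ifs with h
  · simp [h]
  · have hc : (n : ℂ) * I ≠ 0 := mul_ne_zero (by exact_mod_cast h) I_ne_zero
    have := integral_exp_mul_complex (a := 0) (b := 2 * Real.pi) hc
    simp_rw [mul_right_comm (n : ℂ) _ I]
    rw [this]
    have h1 : exp (n * I * ((2 * Real.pi : ℝ) : ℂ)) = 1 := by
      rw [exp_eq_one_iff]
      exact ⟨n, by push_cast; ring⟩
    rw [h1]
    simp

theorem hasSum_integral_exp_series_mul {ι : Type*} [Countable ι] {m : ι → ℤ} {c : ι → ℂ}
    (hc : Summable fun n => ‖c n‖) {f g : ℝ → ℂ}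
    (hf : ∀ θ : ℝ, HasSum (fun n => c n * exp (m n * θ * I)) (f θ)) (hg : Continuous g) :
    HasSum (fun n => ∫ θ in (0 : ℝ)..2 * Real.pi, c n * exp (m n * θ * I) * g θ)
      (∫ θ in (0 : ℝ)..2 * Real.pi, f θ * g θ) := by
  refine intervalIntegral.hasSum_integral_of_dominated_convergence
    (fun n θ => ‖c n‖ * ‖g θ‖) (fun n => ?_) (fun n => ?_) ?_ ?_ ?_
  · exact Continuous.aestronglyMeasurable (by fun_prop)
  · refine Filter.Eventually.of_forall fun θ _ => ?_
    rw [norm_mul, norm_mul, show (m n * θ * I : ℂ) = ((m n * θ : ℝ) : ℂ) * I by push_cast; ring,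
      norm_exp_ofReal_mul_I, mul_one]
  · exact Filter.Eventually.of_forall fun θ _ => hc.mul_right _
  · simp_rw [tsum_mul_right]
    exact (continuous_const.mul hg.norm).intervalIntegrable _ _
  · exact Filter.Eventually.of_forall fun θ _ => (hf θ).mul_right _

/-- **Parseval's identity** for an absolutely convergent trigonometric series. -/
theorem hasSum_norm_sq_exp_series {ι : Type*} [Countable ι] {m : ι → ℤ}
    (hm : Function.Injective m) {c : ι → ℂ} (hc : Summable fun n => ‖c n‖) {f : ℝ → ℂ}
    (hf : ∀ θ : ℝ, HasSum (fun n => c n * exp (m n * θ * I)) (f θ)) :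
    HasSum (fun n => 2 * Real.pi * ‖c n‖ ^ 2) (∫ θ in (0 : ℝ)..2 * Real.pi, ‖f θ‖ ^ 2) := by
  classical
  have hfc : Continuous f := by
    have : f = fun θ : ℝ => ∑' n, c n * exp (m n * θ * I) := funext fun θ => (hf θ).tsum_eq.symm
    rw [this]
    refine continuous_tsum (u := fun n => ‖c n‖) (fun n => by fun_prop) hc fun n θ => ?_
    rw [norm_mul, show (m n * θ * I : ℂ) = ((m n * θ : ℝ) : ℂ) * I by push_cast; ring,
      norm_exp_ofReal_mul_I, mul_one]
  have hconj : ∀ j θ, conj (exp (m j * (θ : ℝ) * I)) = exp (-(m j * θ * I)) := by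
    intro j θ
    rw [← exp_conj]
    simp
  have hcoef : ∀ j, ∫ θ in (0 : ℝ)..2 * Real.pi, f θ * conj (exp (m j * θ * I))
      = 2 * Real.pi * c j := by
    intro j
    have h1 := hasSum_integral_exp_series_mul hc hf
      (g := fun θ => conj (exp (m j * θ * I))) (by fun_prop)
    have h2 : ∀ n, ∫ θ in (0 : ℝ)..2 * Real.pi,
        c n * exp (m n * θ * I) * conj (exp (m j * θ * I))
        = if n = j then 2 * Real.pi * c j else 0 := by
      intro n
      have : ∀ θ : ℝ, c n * exp (m n * θ * I) * conj (exp (m j * θ * I))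
          = c n * exp ((m n - m j : ℤ) * θ * I) := by
        intro θ
        rw [hconj, mul_assoc, ← exp_add]
        congr 2
        push_cast
        ring
      simp_rw [this]
      rw [intervalIntegral.integral_const_mul, integral_exp_int_mul_I]
      simp only [sub_eq_zero, hm.eq_iff]
      split_ifs with h
      · rw [h]; ring
      · simp
    simp_rw [h2] at h1
    exact h1.unique (hasSum_ite_eq j _)
  -- Integrating the series of `f` termwise against `conj f` leaves the conjugate Fourier
  -- coefficients found in `hcoef`.
  have h := hasSum_integral_exp_series_mul hc hf (g := fun θ => conj (f θ)) (by fun_prop)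
  have hterm : ∀ n, ∫ θ in (0 : ℝ)..2 * Real.pi, c n * exp (m n * θ * I) * conj (f θ)
      = ((2 * Real.pi * ‖c n‖ ^ 2 : ℝ) : ℂ) := by
    intro n
    have : ∀ θ : ℝ, c n * exp (m n * θ * I) * conj (f θ)
        = c n * conj (f θ * conj (exp (m n * θ * I))) := by
      intro θ
      simp only [map_mul, conj_conj]
      ring
    simp_rw [this]
    rw [intervalIntegral.integral_const_mul, intervalIntegral.integral_of_le Real.two_pi_pos.le,
      integral_conj, ← intervalIntegral.integral_of_le Real.two_pi_pos.le, hcoef]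
    push_cast
    rw [← mul_conj']
    simp only [map_mul, conj_ofReal, map_ofNat]
    ring
  simp_rw [hterm, mul_conj'] at h
  rw [← hasSum_ofReal]
  convert h using 1
  rw [← intervalIntegral.integral_ofReal]
  push_cast
  rfl

end Parseval

/-! ### Binomial series and the hypergeometric function -/

section Hypergeometric

open Complex

theorem hasSum_one_div_one_sub_cpow (a : ℂ) {w : ℂ} (hw : ‖w‖ < 1) :
    HasSum (fun n => Ring.multichoose a n * w ^ n) (1 / (1 - w) ^ a) := by
  have h := (one_div_one_sub_cpow_hasFPowerSeriesOnBall_zero a).hasSum (y := w)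
    (by simpa [Metric.mem_eball, edist_zero_right, ← ofReal_norm] using hw)
  simpa [Ring.multichoose_eq, FormalMultilinearSeries.ofScalars_apply_eq, mul_comm] using! h

theorem summable_norm_multichoose_mul_pow (a : ℂ) {w : ℂ} (hw : ‖w‖ < 1) :
    Summable fun n => ‖Ring.multichoose a n * w ^ n‖ :=
  (hasSum_one_div_one_sub_cpow a hw).summable.norm

theorem multichoose_eq_ascPochhammer_div (p : ℝ) (n : ℕ) :
    Ring.multichoose p n = (ascPochhammer ℝ n).eval p / n.factorial := by
  rw [eq_div_iff (by positivity), mul_comm, ← nsmul_eq_mul,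
    Ring.factorial_nsmul_multichoose_eq_ascPochhammer, Polynomial.ascPochhammer_smeval_eq_eval]

theorem ordinaryHypergeometric_self_self_one (p x : ℝ) :
    ordinaryHypergeometric p p (1 : ℝ) x = ∑' n : ℕ, Ring.multichoose p n ^ 2 * x ^ n := by
  rw [ordinaryHypergeometric_eq_tsum]
  refine tsum_congr fun n => ?_
  rw [multichoose_eq_ascPochhammer_div, ascPochhammer_eval_one, smul_eq_mul]
  field_simp

/-- Halving the exponent makes the integrand the squared norm of a function with an explicit Fourier
series, whose frequencies are the multiples of `ν`. -/
theorem integral_norm_one_sub_cpow {ν : ℕ} (hν : 0 < ν) (p : ℝ) {r : ℝ} (hr : 0 ≤ r)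
    (hr1 : r < 1) :
    ∫ θ in (0 : ℝ)..2 * Real.pi, ‖1 / (1 - circleMap 0 r θ ^ ν) ^ ((2 * p : ℝ) : ℂ)‖
      = 2 * Real.pi * ordinaryHypergeometric p p (1 : ℝ) (r ^ (2 * ν)) := by
  have hrν : r ^ ν < 1 := pow_lt_one₀ hr hr1 hν.ne'
  have hw : ∀ θ, ‖circleMap 0 r θ ^ ν‖ < 1 := by
    intro θ
    rw [norm_pow, norm_circleMap_zero, abs_of_nonneg hr]
    exact hrν
  have hm : Function.Injective fun n : ℕ => ((n * ν : ℕ) : ℤ) := by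
    intro i j hij
    exact Nat.eq_of_mul_eq_mul_right hν (Nat.cast_injective hij)
  -- The binomial series at the real point `r ^ ν` has as its terms the Fourier coefficients on the
  -- circle.
  have hc := summable_norm_multichoose_mul_pow (p : ℂ) (w := ((r ^ ν : ℝ) : ℂ))
    (by rwa [norm_real, Real.norm_of_nonneg (by positivity)])
  have h := hasSum_norm_sq_exp_series hm hc
    (f := fun θ => 1 / (1 - circleMap 0 r θ ^ ν) ^ (p : ℂ)) (fun θ : ℝ => by
      convert hasSum_one_div_one_sub_cpow (p : ℂ) (hw θ) using 2 with n
      rw [circleMap_zero, mul_pow, mul_pow, ← exp_nat_mul, ← exp_nat_mul, mul_assoc]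
      push_cast
      congr 3
      ring)
  rw [ordinaryHypergeometric_self_self_one, ← tsum_mul_left]
  calc _ = ∫ θ in (0 : ℝ)..2 * Real.pi, ‖1 / (1 - circleMap 0 r θ ^ ν) ^ (p : ℂ)‖ ^ 2 := by
        refine intervalIntegral.integral_congr fun θ _ => ?_
        have h0 : 1 - circleMap 0 r θ ^ ν ≠ 0 := by
          intro h0
          have := hw θ
          rw [← sub_eq_zero.1 h0] at this
          simp at this
        simp only [norm_div, norm_one, norm_cpow_of_ne_zero h0, ofReal_re, ofReal_im, mul_zero,
          Real.exp_zero, div_one]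
        rw [two_mul, Real.rpow_add (norm_pos_iff.2 h0)]
        field_simp
    _ = _ := by
        rw [← h.tsum_eq]
        refine tsum_congr fun n => ?_
        have : Ring.multichoose (p : ℂ) n = ((Ring.multichoose p n : ℝ) : ℂ) := by
          rw [Ring.multichoose_eq, Ring.multichoose_eq, ofReal_choose]
          push_cast
          rfl
        rw [this, ← ofReal_pow, ← ofReal_mul, norm_real, Real.norm_eq_abs, sq_abs]
        ring

end Hypergeometric

/-! ### Inverting a locally injective holomorphic map -/

open Filter Topology in
/-- An analytic right inverse of a locally injective holomorphic map that takes values in its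
connected domain is a left inverse as well. -/
theorem analytic_rightInverse_leftInvOn {U : Set ℂ} (hU : IsOpen U) (hUc : IsPreconnected U)
    {G φ : ℂ → ℂ} (hG : DifferentiableOn ℂ G U) (hG' : ∀ z ∈ U, deriv G z ≠ 0)
    (hφ : AnalyticOnNhd ℂ φ (G '' U)) (hmaps : Set.MapsTo φ (G '' U) U)
    (hinv : ∀ w ∈ G '' U, G (φ w) = w) : Set.LeftInvOn φ G U := by
  intro z₀ hz₀
  have hGa : AnalyticOnNhd ℂ G U := hG.analyticOnNhd hU
  have hh : AnalyticOnNhd ℂ (φ ∘ G) U := hφ.comp hGa (Set.mapsTo_image G U)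
  have hGh : ∀ z ∈ U, G (φ (G z)) = G z := fun z hz => hinv _ (Set.mem_image_of_mem G hz)
  -- `w` is a fixed point of `φ ∘ G`. Near it `G` is injective and `G ∘ φ ∘ G = G`, so `φ ∘ G` is
  -- the identity there, hence on all of `U`.
  set w := φ (G z₀) with hw
  have hwU : w ∈ U := hmaps (Set.mem_image_of_mem G hz₀)
  have hfix : (φ ∘ G) w = w := by rw [Function.comp_apply, hw, hGh z₀ hz₀]
  have hstrict := (hGa w hwU).hasStrictDerivAt
  have hloc := hstrict.eventually_left_inverse (hG' w hwU)
  have htend : Tendsto (φ ∘ G) (𝓝 w) (𝓝 w) := by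
    have := (hh w hwU).continuousAt.tendsto
    rwa [hfix] at this
  have heq : φ ∘ G =ᶠ[𝓝 w] id := by
    filter_upwards [hloc, htend.eventually hloc, hU.mem_nhds hwU] with z h1 h2 hz
    rw [Function.comp_apply, hGh z hz, h1] at h2
    exact h2.symm
  exact hh.eqOn_of_preconnected_of_eventuallyEq analyticOnNhd_id hUc hwU heq hz₀

/-! ### The integral `F` and the lemniscates of `φ` -/

section DFunction

open Complex

theorem one_sub_pow_mem_slitPlane {ν : ℕ} (hν : 0 < ν) {z : ℂ} (hz : ‖z‖ < 1) :
    1 - z ^ ν ∈ slitPlane := by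
  rw [sub_eq_add_neg]
  refine mem_slitPlane_of_norm_lt_one ?_
  rw [norm_neg, norm_pow]
  exact pow_lt_one₀ (norm_nonneg _) hz hν.ne'

theorem differentiableOn_one_div_one_sub_pow_cpow {ν : ℕ} (hν : 0 < ν) (a : ℂ) :
    DifferentiableOn ℂ (fun z : ℂ => 1 / (1 - z ^ ν) ^ a) (Metric.ball 0 1) := by
  intro z hz
  have hs := one_sub_pow_mem_slitPlane hν (mem_ball_zero_iff.1 hz)
  refine DifferentiableAt.differentiableWithinAt ?_
  refine (differentiableAt_const _).div (DifferentiableAt.cpow_const (by fun_prop) hs) ?_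
  exact fun h => slitPlane_ne_zero hs ((cpow_eq_zero_iff _ _).1 h).1

/-- The integrand is holomorphic on the disk, so it has a primitive `P` there with `P 0 = 0`;
integrating along the segment identifies `F` with `P`. -/
theorem hasDerivAt_dIntegral {ν : ℕ} (hν : 0 < ν) (k : ℝ) {z : ℂ} (hz : ‖z‖ < 1) :
    HasDerivAt (dIntegral ν k) (1 / (1 - z ^ ν) ^ (((k + 1) / (ν : ℝ) : ℝ) : ℂ)) z := by
  set a : ℂ := (((k + 1) / (ν : ℝ) : ℝ) : ℂ) with ha
  have hd := differentiableOn_one_div_one_sub_pow_cpow hν a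
  obtain ⟨P, hP0, hP⟩ := hd.isExactOn_ball.with_val_at 0 0
  have heq : ∀ w ∈ Metric.ball (0 : ℂ) 1, dIntegral ν k w = P w := by
    intro w hw
    rw [mem_ball_zero_iff] at hw
    have hmem : ∀ s ∈ Set.uIcc (0 : ℝ) 1, (s : ℂ) * w ∈ Metric.ball (0 : ℂ) 1 := by
      intro s hs
      rw [Set.uIcc_of_le zero_le_one] at hs
      rw [mem_ball_zero_iff, norm_mul, norm_real, Real.norm_of_nonneg hs.1]
      exact (mul_le_of_le_one_left (norm_nonneg _) hs.2).trans_lt hw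
    have hder : ∀ s ∈ Set.uIcc (0 : ℝ) 1, HasDerivAt (fun s : ℝ => P (s * w))
        (w / (1 - ((s : ℂ) * w) ^ ν) ^ a) s := by
      intro s hs
      have h1 : HasDerivAt (fun s : ℝ => (s : ℂ) * w) (1 * w) s :=
        (ofRealCLM.hasDerivAt (x := s)).mul_const w
      exact ((hP _ (hmem s hs)).comp s h1).congr_deriv (by ring)
    have hcont : ContinuousOn (fun s : ℝ => w / (1 - ((s : ℂ) * w) ^ ν) ^ a)
        (Set.uIcc 0 1) := by
      have := (hd.continuousOn.comp (f := fun s : ℝ => (s : ℂ) * w) (by fun_prop) hmem)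
      convert continuousOn_const (c := w) |>.mul this using 2 with s
      simp [div_eq_mul_inv]
    have := intervalIntegral.integral_eq_sub_of_hasDerivAt hder hcont.intervalIntegrable
    rw [dIntegral, this]
    simp [hP0]
  refine (hP z (mem_ball_zero_iff.2 hz)).congr_of_eventuallyEq ?_
  filter_upwards [Metric.isOpen_ball.mem_nhds (mem_ball_zero_iff.2 hz)] with w hw
  exact heq w hw

theorem dIntegral_zero (ν : ℕ) (k : ℝ) : dIntegral ν k 0 = 0 := by
  simp [dIntegral]

theorem hasDerivAt_one_div_mul_dIntegral {ν : ℕ} (hν : 0 < ν) (k : ℝ) (C : ℂ) {z : ℂ}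
    (hz : ‖z‖ < 1) :
    HasDerivAt (fun ζ => 1 / C * dIntegral ν k ζ)
      (1 / C * (1 / (1 - z ^ ν) ^ (((k + 1) / (ν : ℝ) : ℝ) : ℂ))) z :=
  (hasDerivAt_dIntegral hν k hz).const_mul _

/-- A `𝒟`-function is the full inverse of `F / C`: in particular `F` is injective as soon as
there is a `𝒟`-function. -/
theorem IsDFunction.leftInvOn {ν : ℕ} (hν : 0 < ν) {k : ℝ} {C : ℂ} (hC : C ≠ 0) {φ : ℂ → ℂ}
    (hφ : IsDFunction ν k C φ) :
    Set.LeftInvOn φ (fun ζ => 1 / C * dIntegral ν k ζ) (Metric.ball 0 1) := by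
  have hd : ∀ z ∈ Metric.ball (0 : ℂ) 1, _ := fun z hz =>
    hasDerivAt_one_div_mul_dIntegral hν k C (mem_ball_zero_iff.1 hz)
  refine analytic_rightInverse_leftInvOn Metric.isOpen_ball
    (convex_ball (0 : ℂ) 1).isPreconnected
    (fun z hz => (hd z hz).differentiableAt.differentiableWithinAt) (fun z hz => ?_)
    hφ.analytic hφ.mapsTo (fun w hw => ?_)
  · rw [(hd z hz).deriv]
    have hs := one_sub_pow_mem_slitPlane hν (mem_ball_zero_iff.1 hz)
    refine mul_ne_zero (one_div_ne_zero hC) (one_div_ne_zero fun h => ?_)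
    exact slitPlane_ne_zero hs ((cpow_eq_zero_iff _ _).1 h).1
  · have := hφ.dIntegral_eq w hw
    simp only [this]
    field_simp

theorem IsDFunction.lemniscateIn_eq {ν : ℕ} (hν : 0 < ν) {k : ℝ} {C : ℂ} (hC : C ≠ 0)
    {φ : ℂ → ℂ} (hφ : IsDFunction ν k C φ) {t : ℝ} (ht : t < 0) :
    lemniscateIn (dDomain ν k C \ {0}) φ t =
      (fun θ => 1 / C * dIntegral ν k (circleMap 0 (Real.exp t) θ)) ''
        Set.Ioc 0 (2 * Real.pi) := by
  have hinv := hφ.leftInvOn hν hC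
  have hsphere := image_circleMap_Ioc 0 (Real.exp t)
  rw [abs_of_pos (Real.exp_pos t)] at hsphere
  rw [← Set.image_image (fun ζ => 1 / C * dIntegral ν k ζ) (circleMap 0 (Real.exp t)), hsphere]
  ext w
  simp only [lemniscateIn, Set.mem_ofPred_eq, Set.mem_sdiff, Set.mem_singleton_iff, Set.mem_image,
    mem_sphere_zero_iff_norm]
  constructor
  · rintro ⟨⟨⟨ζ, hζ, rfl⟩, -⟩, hw⟩
    exact ⟨ζ, by rwa [hinv hζ] at hw, rfl⟩
  · rintro ⟨ζ, hζ, rfl⟩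
    have hball : ζ ∈ Metric.ball (0 : ℂ) 1 := by
      rw [mem_ball_zero_iff, hζ]
      simpa using ht
    refine ⟨⟨⟨ζ, hball, rfl⟩, fun h0 => ?_⟩, by rw [hinv hball, hζ]⟩
    -- Deleting `0` from the domain loses nothing: `G ζ = 0 = G 0` would force `ζ = 0`, against `‖ζ‖
    -- = e^t`.
    have hzero := hinv (Metric.mem_ball_self (x := (0 : ℂ)) one_pos)
    have hζ' := hinv hball
    simp only [dIntegral_zero, mul_zero] at hzero
    simp only [h0, hzero] at hζ'
    rw [← hζ', norm_zero] at hζ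
    exact (Real.exp_pos t).ne hζ

end DFunction

/-! ### The length formula -/

theorem mainTheorem6 (ν : ℕ) (hν : 0 < ν) (k : ℝ) (hk : k ≤ (ν : ℝ) - 1)
    (C : ℂ) (hC : C ≠ 0) (φ : ℂ → ℂ) (hφ : IsDFunction ν k C φ)
    (p : ℝ) (hp : p = (k + 1) / (2 * (ν : ℝ))) (t : ℝ) (ht : t < 0) :
    lemniscateLength (dDomain ν k C \ {0}) φ t =
      ENNReal.ofReal (2 * Real.pi * Real.exp t / ‖C‖ *
        ordinaryHypergeometric p p (1 : ℝ) (Real.exp (2 * (ν : ℝ) * t))) := by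
  have hr1 : Real.exp t < 1 := by simpa using ht
  have hnorm : ∀ θ, ‖circleMap 0 (Real.exp t) θ‖ < 1 := fun θ => by
    rwa [norm_circleMap_zero, abs_of_pos (Real.exp_pos t)]
  have hball : ∀ θ, circleMap 0 (Real.exp t) θ ∈ Metric.ball (0 : ℂ) 1 := fun θ =>
    mem_ball_zero_iff.2 (hnorm θ)
  have hinj : Set.InjOn (fun θ => 1 / C * dIntegral ν k (circleMap 0 (Real.exp t) θ))
      (Set.Ioc 0 (2 * Real.pi)) := by
    -- The half-open interval covers each point of the circle exactly once.
    have hcirc := injOn_circleMap_of_abs_sub_le (a := 0) (b := 2 * Real.pi) (c := 0)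
      (Real.exp_pos t).ne' (by rw [zero_sub, abs_neg, abs_of_pos Real.two_pi_pos])
    rw [Set.uIoc_of_le Real.two_pi_pos.le] at hcirc
    exact (hφ.leftInvOn hν hC).injOn.comp hcirc fun θ _ => hball θ
  have hderiv : ∀ θ, HasDerivAt (fun θ => 1 / C * dIntegral ν k (circleMap 0 (Real.exp t) θ))
      (1 / C * (1 / (1 - circleMap 0 (Real.exp t) θ ^ ν) ^ (((k + 1) / (ν : ℝ) : ℝ) : ℂ)) *
        (circleMap 0 (Real.exp t) θ * Complex.I)) θ := fun θ =>
    (hasDerivAt_one_div_mul_dIntegral hν k C (hnorm θ)).comp θ (hasDerivAt_circleMap 0 _ θ)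
  have hcont : Continuous fun θ =>
      1 / C * (1 / (1 - circleMap 0 (Real.exp t) θ ^ ν) ^ (((k + 1) / (ν : ℝ) : ℝ) : ℂ)) *
        (circleMap 0 (Real.exp t) θ * Complex.I) := by
    have := (differentiableOn_one_div_one_sub_pow_cpow hν
      (((k + 1) / (ν : ℝ) : ℝ) : ℂ)).continuousOn.comp_continuous
      (continuous_circleMap 0 (Real.exp t)) hball
    fun_prop
  rw [lemniscateLength, hφ.lemniscateIn_eq hν hC ht,
    hausdorffMeasure_image_Ioc_eq_integral_norm_deriv hderiv hcont Real.two_pi_pos.le hinj]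
  have hpe : (k + 1) / (ν : ℝ) = 2 * p := by
    rw [hp]
    field_simp
  have hexp : Real.exp (2 * (ν : ℝ) * t) = Real.exp t ^ (2 * ν) := by
    rw [← Real.exp_nat_mul]
    push_cast
    rfl
  have hint := integral_norm_one_sub_cpow hν p (Real.exp_pos t).le hr1
  congr 1
  calc _ = ∫ θ in (0 : ℝ)..2 * Real.pi, Real.exp t / ‖C‖ *
        ‖1 / (1 - circleMap 0 (Real.exp t) θ ^ ν) ^ ((2 * p : ℝ) : ℂ)‖ := by
        refine intervalIntegral.integral_congr fun θ _ => ?_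
        simp only [hpe, norm_mul, norm_div, norm_one, Complex.norm_I, norm_circleMap_zero,
          abs_of_pos (Real.exp_pos t)]
        ring
    _ = _ := by
        rw [intervalIntegral.integral_const_mul, hint, hexp]
        ring
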